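/- Let $K$ be a field with an involution $k\mapsto\overline{k}$, that is, an additive map with $\overline{kl}=\overline{l}\,\overline{k}$ and $\overline{\overline{k}}=k$. A graph $E=(E^0,E^1,r,s)$ consists of arbitrary sets $E^0$ of vertices and $E^1$ of edges and maps $r,s:E^1\to E^0$. The Leavitt path algebra $L_K(E)$ is the associative, not necessarily unital, $K$-algebra generated by $E^0\cup E^1\cup\{e^*\mid e\in E^1\}$ with the relations - (V) $vw=\delta_{v,w}v$ for all $v,w\in E^0$; - (P1) $s(e)e=er(e)=e$ for all $e\in E^1$; - (P2) $r(e)e^*=e^*s(e)=e^*$ for all $e\in E^1$; - (CK1) $e^*f=\delta_{e,f}r(e)$ for all $e,f\in E^1$; - (CK2) $v=\sum_{e\in s^{-1}(v)}ee^*$ for every $v\in E^0$ such that $s^{-1}(v)$ is finite and nonempty. It carries the involution induced by that of $K$, namely $\left(\sum_i k_ip_iq_i^*\right)^*=\sum_i\overline{k_i}\,q_ip_i^*$ for $k_i\in K$ and paths $p_i,q_i$ in $E$; here a path is a vertex, with $v^*=v$, or a sequence of edges $e_1\cdots e_m$ with $r(e_i)=s(e_{i+1})$, with $(e_1\cdots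 e_m)^*=e_m^*\cdots e_1^*$. An involution $*$ on a ring $R$ is called positive definite if for every positive integer $n$ and all $x_1,\dots,x_n\in R$, $x_1^*x_1+\dots+x_n^*x_n=0$ implies $x_1=\dots=x_n=0$. **Proposition 2.4.** The following conditions are equivalent: 1. The involution on $K$ is positive definite. 2. The involution on $L_K(E)$ is positive definite for every graph $E$. 3. The involution on $L_K(E)$ is positive definite for some graph $E$ with $E^0\neq\emptyset$. Thus, if $E$ is an arbitrary graph with $E^0\neq\emptyset$, then $L_K(E)$ is positive definite if and only if $K$ is positive definite. -/

import Mathlib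

universe u v w

/-- A directed graph: a type of vertices, a type of edges, and source and range maps. -/
structure DirectedGraph where
  /-- The vertices `E⁰`. -/
  Vertex : Type u
  /-- The edges `E¹`. -/
  Edge : Type v
  /-- The source map `s`. -/
  source : Edge → Vertex
  /-- The range map `r`. -/
  range : Edge → Vertex

/-- The involution of `R` is `n`-proper:
`x₁⋆ x₁ + ⋯ + xₙ⋆ xₙ = 0` implies `x₁ = ⋯ = xₙ = 0`. -/
def IsNProper (n : ℕ) (R : Type w) [NonUnitalRing R] [StarRing R] : Prop :=
  ∀ x : Fin n → R, ∑ i, star (x i) * x i = 0 → ∀ i, x i = 0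

/-- The involution of `R` is positive definite: `n`-proper for every positive integer `n`. -/
def IsPositiveDefinite (R : Type w) [NonUnitalRing R] [StarRing R] : Prop :=
  ∀ n : ℕ, 0 < n → IsNProper n R

namespace LeavittPath

/-- The generating set `E⁰ ∪ E¹ ∪ {e⋆ | e ∈ E¹}` (disjoint union). -/
inductive Generator (E : DirectedGraph.{u, v}) : Type (max u v)
  | vertex (x : E.Vertex) : Generator E
  | edge (e : E.Edge) : Generator E
  | ghost (e : E.Edge) : Generator E

/-- The formal adjoint of a generator: vertices are fixed, `e` and `e⋆` are exchanged. -/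
def Generator.adjoint {E : DirectedGraph.{u, v}} : Generator E → Generator E
  | .vertex x => .vertex x
  | .edge e => .ghost e
  | .ghost e => .edge e

theorem Generator.adjoint_adjoint {E : DirectedGraph.{u, v}} (g : Generator E) :
    g.adjoint.adjoint = g := by
  cases g <;> rfl

/-- Reversal of words, replacing every letter by its adjoint. -/
def wordAdjoint {E : DirectedGraph.{u, v}} (p : FreeSemigroup (Generator E)) :
    FreeSemigroup (Generator E) :=
  (FreeSemigroup.lift (fun g => MulOpposite.op (FreeSemigroup.of g.adjoint)) p).unop

theorem wordAdjoint_of {E : DirectedGraph.{u, v}} (g : Generator E) :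
    wordAdjoint (FreeSemigroup.of g) = FreeSemigroup.of g.adjoint := rfl

theorem wordAdjoint_mul {E : DirectedGraph.{u, v}} (p q : FreeSemigroup (Generator E)) :
    wordAdjoint (p * q) = wordAdjoint q * wordAdjoint p := by
  simp [wordAdjoint]

theorem wordAdjoint_wordAdjoint {E : DirectedGraph.{u, v}} (p : FreeSemigroup (Generator E)) :
    wordAdjoint (wordAdjoint p) = p := by
  induction p using FreeSemigroup.recOnMul with
  | ih1 g => rw [wordAdjoint_of, wordAdjoint_of, Generator.adjoint_adjoint]
  | ih2 g p hg hp => rw [wordAdjoint_mul, wordAdjoint_mul, hg, hp]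

/-- The free associative, not necessarily unital, `K`-algebra on the generators: its basis is
the set of nonempty words in the generators. -/
abbrev FreeAlg (K : Type w) [Field K] (E : DirectedGraph.{u, v}) : Type (max u v w) :=
  MonoidAlgebra K (FreeSemigroup (Generator E))

noncomputable section

section Relations

variable (K : Type w) [Field K] {E : DirectedGraph.{u, v}}

/-- A generator as an element of the free algebra. -/
def gen (g : Generator E) : FreeAlg K E := MonoidAlgebra.single (FreeSemigroup.of g) 1

/-- The vertex `x` as an element of the free algebra. -/
abbrev vtx (x : E.Vertex) : FreeAlg K E := gen K (.vertex x)

/-- The edge `e` as an element of the free algebra. -/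
abbrev edg (e : E.Edge) : FreeAlg K E := gen K (.edge e)

/-- The ghost edge `e⋆` as an element of the free algebra. -/
abbrev gho (e : E.Edge) : FreeAlg K E := gen K (.ghost e)

/-- The defining relations (V), (P1), (P2), (CK1), (CK2) of the Leavitt path algebra. -/
inductive Rel : FreeAlg K E → FreeAlg K E → Prop
  | vertex_self (x : E.Vertex) : Rel (vtx K x * vtx K x) (vtx K x)
  | vertex_ne (x y : E.Vertex) (h : x ≠ y) : Rel (vtx K x * vtx K y) 0
  | source_edge (e : E.Edge) : Rel (vtx K (E.source e) * edg K e) (edg K e)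
  | edge_range (e : E.Edge) : Rel (edg K e * vtx K (E.range e)) (edg K e)
  | range_ghost (e : E.Edge) : Rel (vtx K (E.range e) * gho K e) (gho K e)
  | ghost_source (e : E.Edge) : Rel (gho K e * vtx K (E.source e)) (gho K e)
  | ck1_self (e : E.Edge) : Rel (gho K e * edg K e) (vtx K (E.range e))
  | ck1_ne (e f : E.Edge) (h : e ≠ f) : Rel (gho K e * edg K f) 0
  | ck2 (x : E.Vertex) (hfin : {e : E.Edge | E.source e = x}.Finite)
      (hne : {e : E.Edge | E.source e = x}.Nonempty) :
      Rel (vtx K x) (∑ e ∈ hfin.toFinset, edg K e * gho K e)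

/-- A ring congruence on the free algebra that is compatible with scalars and contains the
defining relations. -/
def IsAdmissible (c : RingCon (FreeAlg K E)) : Prop :=
  (∀ (k : K) (a b : FreeAlg K E), c a b → c (k • a) (k • b)) ∧
    ∀ a b : FreeAlg K E, Rel K a b → c a b

variable (E) in
/-- The smallest `K`-algebra congruence containing the defining relations. -/
def con : RingCon (FreeAlg K E) := sInf {c | IsAdmissible K c}

theorem con_iff {a b : FreeAlg K E} :
    con K E a b ↔ ∀ c : RingCon (FreeAlg K E), IsAdmissible K c → c a b := Iff.rfl

theorem con_isAdmissible : IsAdmissible K (con K E) :=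
  ⟨fun k _ _ h c hc => hc.1 k _ _ (h c hc), fun _ _ h _ hc => hc.2 _ _ h⟩

end Relations

section FreeAdjoint

variable {K : Type w} [Field K] [StarRing K] {E : DirectedGraph.{u, v}}

/-- The conjugate-linear map of the free algebra that sends a word to its adjoint. -/
def freeAdjoint (a : FreeAlg K E) : FreeAlg K E :=
  MonoidAlgebra.ofCoeff ((a.coeff.mapRange star (star_zero K)).mapDomain wordAdjoint)

theorem freeAdjoint_single (p : FreeSemigroup (Generator E)) (k : K) :
    freeAdjoint (MonoidAlgebra.single p k : FreeAlg K E) =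
      MonoidAlgebra.single (wordAdjoint p) (star k) := by
  simp [freeAdjoint, Finsupp.mapDomain_single]

theorem freeAdjoint_zero : freeAdjoint (0 : FreeAlg K E) = 0 := by
  simp [freeAdjoint]

theorem freeAdjoint_add (a b : FreeAlg K E) :
    freeAdjoint (a + b) = freeAdjoint a + freeAdjoint b := by
  simp [freeAdjoint, Finsupp.mapRange_add (hf := star_zero K) star_add, Finsupp.mapDomain_add]

theorem freeAdjoint_freeAdjoint (a : FreeAlg K E) : freeAdjoint (freeAdjoint a) = a := by
  induction a using MonoidAlgebra.induction_linear with
  | zero => simp [freeAdjoint_zero]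
  | add a b ha hb => rw [freeAdjoint_add, freeAdjoint_add, ha, hb]
  | single p k => rw [freeAdjoint_single, freeAdjoint_single, wordAdjoint_wordAdjoint, star_star]

theorem freeAdjoint_mul (a b : FreeAlg K E) :
    freeAdjoint (a * b) = freeAdjoint b * freeAdjoint a := by
  induction a using MonoidAlgebra.induction_linear with
  | zero => simp [freeAdjoint_zero]
  | add a a' ha ha' => rw [add_mul, freeAdjoint_add, ha, ha', freeAdjoint_add, mul_add]
  | single p k =>
    induction b using MonoidAlgebra.induction_linear with
    | zero => simp [freeAdjoint_zero]
    | add b b' hb hb' => rw [mul_add, freeAdjoint_add, hb, hb', freeAdjoint_add, add_mul]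
    | single q l =>
      simp only [MonoidAlgebra.single_mul_single, freeAdjoint_single, wordAdjoint_mul, star_mul]

theorem freeAdjoint_smul (k : K) (a : FreeAlg K E) :
    freeAdjoint (k • a) = star k • freeAdjoint a := by
  induction a using MonoidAlgebra.induction_linear with
  | zero => simp [freeAdjoint_zero]
  | add a b ha hb => rw [smul_add, freeAdjoint_add, ha, hb, freeAdjoint_add, smul_add]
  | single p l => simp [MonoidAlgebra.smul_single, freeAdjoint_single]

theorem freeAdjoint_gen (g : Generator E) : freeAdjoint (gen K g) = gen K g.adjoint := by
  rw [gen, gen, freeAdjoint_single, star_one, wordAdjoint_of]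

theorem freeAdjoint_sum {ι : Type*} (s : Finset ι) (f : ι → FreeAlg K E) :
    freeAdjoint (∑ i ∈ s, f i) = ∑ i ∈ s, freeAdjoint (f i) :=
  map_sum (AddMonoidHom.mk' (freeAdjoint (K := K) (E := E)) freeAdjoint_add) f s

/-- The adjoints of the defining relations are again defining relations. -/
theorem rel_freeAdjoint {a b : FreeAlg K E} (h : Rel K a b) :
    Rel K (freeAdjoint a) (freeAdjoint b) := by
  cases h <;> simp only [freeAdjoint_mul, freeAdjoint_gen, freeAdjoint_zero, freeAdjoint_sum,
    Generator.adjoint]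
  · exact .vertex_self _
  · exact .vertex_ne _ _ (Ne.symm ‹_›)
  · exact .ghost_source _
  · exact .range_ghost _
  · exact .edge_range _
  · exact .source_edge _
  · exact .ck1_self _
  · exact .ck1_ne _ _ (Ne.symm ‹_›)
  · exact .ck2 _ _ ‹_›

theorem con_freeAdjoint {a b : FreeAlg K E} (h : con K E a b) :
    con K E (freeAdjoint a) (freeAdjoint b) := by
  intro c hc
  let d : RingCon (FreeAlg K E) :=
    { r := fun a b => c (freeAdjoint a) (freeAdjoint b)
      iseqv := ⟨fun _ => c.refl _, fun h => c.symm h, fun h h' => c.trans h h'⟩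
      add' := fun h h' => by
        simp only [freeAdjoint_add]; exact c.add h h'
      mul' := fun h h' => by
        simp only [freeAdjoint_mul]; exact c.mul h' h }
  have hd : IsAdmissible K d := by
    refine ⟨fun k a b hab => ?_, fun a b hab => hc.2 _ _ (rel_freeAdjoint hab)⟩
    change c (freeAdjoint (k • a)) (freeAdjoint (k • b))
    rw [freeAdjoint_smul, freeAdjoint_smul]
    exact hc.1 _ _ _ hab
  exact h d hd

end FreeAdjoint

end

end LeavittPath

/-- The Leavitt path algebra `L_K(E)`: the (not necessarily unital) associative `K`-algebra
generated by `E⁰ ∪ E¹ ∪ {e⋆ | e ∈ E¹}` with the relations (V), (P1), (P2), (CK1), (CK2). -/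
def LeavittPathAlgebra (K : Type w) [Field K] (E : DirectedGraph.{u, v}) : Type (max u v w) :=
  (LeavittPath.con K E).Quotient

namespace LeavittPathAlgebra

open LeavittPath

noncomputable section

variable {K : Type w} [Field K] {E : DirectedGraph.{u, v}}

instance : NonUnitalRing (LeavittPathAlgebra K E) :=
  inferInstanceAs (NonUnitalRing (LeavittPath.con K E).Quotient)

/-- The quotient map from the free algebra. -/
def mk : FreeAlg K E → LeavittPathAlgebra K E := fun a => (a : (LeavittPath.con K E).Quotient)

theorem mk_surjective : Function.Surjective (mk : FreeAlg K E → LeavittPathAlgebra K E) :=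
  Quotient.mk_surjective

theorem mk_eq_mk {a b : FreeAlg K E} :
    (mk a : LeavittPathAlgebra K E) = mk b ↔ LeavittPath.con K E a b :=
  RingCon.eq _

theorem mk_zero : (mk 0 : LeavittPathAlgebra K E) = 0 := rfl

theorem mk_add (a b : FreeAlg K E) : (mk (a + b) : LeavittPathAlgebra K E) = mk a + mk b := rfl

theorem mk_mul (a b : FreeAlg K E) : (mk (a * b) : LeavittPathAlgebra K E) = mk a * mk b := rfl

instance : SMul K (LeavittPathAlgebra K E) where
  smul k := Quotient.map' (k • ·) fun _ _ h => (con_isAdmissible K).1 k _ _ h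

theorem mk_smul (k : K) (a : FreeAlg K E) :
    (mk (k • a) : LeavittPathAlgebra K E) = k • mk a := rfl

instance : Module K (LeavittPathAlgebra K E) where
  one_smul x := by
    obtain ⟨a, rfl⟩ := mk_surjective x
    rw [← mk_smul, one_smul]
  mul_smul k l x := by
    obtain ⟨a, rfl⟩ := mk_surjective x
    rw [← mk_smul, ← mk_smul, ← mk_smul, mul_smul]
  smul_zero k := by rw [← mk_zero, ← mk_smul, smul_zero]
  smul_add k x y := by
    obtain ⟨a, rfl⟩ := mk_surjective x
    obtain ⟨b, rfl⟩ := mk_surjective y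
    rw [← mk_add, ← mk_smul, ← mk_smul, ← mk_smul, ← mk_add, smul_add]
  add_smul k l x := by
    obtain ⟨a, rfl⟩ := mk_surjective x
    rw [← mk_smul, ← mk_smul, ← mk_smul, ← mk_add, add_smul]
  zero_smul x := by
    obtain ⟨a, rfl⟩ := mk_surjective x
    rw [← mk_smul, zero_smul, mk_zero]

instance : IsScalarTower K (LeavittPathAlgebra K E) (LeavittPathAlgebra K E) where
  smul_assoc k x y := by
    obtain ⟨a, rfl⟩ := mk_surjective x
    obtain ⟨b, rfl⟩ := mk_surjective y
    simp only [smul_eq_mul]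
    rw [← mk_smul, ← mk_mul, ← mk_mul, ← mk_smul, smul_mul_assoc]

instance : SMulCommClass K (LeavittPathAlgebra K E) (LeavittPathAlgebra K E) where
  smul_comm k x y := by
    obtain ⟨a, rfl⟩ := mk_surjective x
    obtain ⟨b, rfl⟩ := mk_surjective y
    simp only [smul_eq_mul]
    rw [← mk_smul, ← mk_mul, ← mk_mul, ← mk_smul, mul_smul_comm]

section Involution

variable [StarRing K]

instance : Star (LeavittPathAlgebra K E) where
  star := Quotient.map' freeAdjoint fun _ _ h => con_freeAdjoint h

theorem star_mk (a : FreeAlg K E) :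
    star (mk a : LeavittPathAlgebra K E) = mk (freeAdjoint a) := rfl

/-- The involution of `L_K(E)` induced by the involution of `K`: the conjugate-linear
anti-automorphism fixing the vertices and exchanging `e` and `e⋆`; hence it maps
`∑ kᵢ pᵢ qᵢ⋆` to `∑ (star kᵢ) qᵢ pᵢ⋆`. -/
instance : StarRing (LeavittPathAlgebra K E) where
  star_involutive x := by
    obtain ⟨a, rfl⟩ := mk_surjective x
    rw [star_mk, star_mk, freeAdjoint_freeAdjoint]
  star_mul x y := by
    obtain ⟨a, rfl⟩ := mk_surjective x
    obtain ⟨b, rfl⟩ := mk_surjective y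
    rw [← mk_mul, star_mk, star_mk, star_mk, ← mk_mul, freeAdjoint_mul]
  star_add x y := by
    obtain ⟨a, rfl⟩ := mk_surjective x
    obtain ⟨b, rfl⟩ := mk_surjective y
    rw [← mk_add, star_mk, star_mk, star_mk, ← mk_add, freeAdjoint_add]

instance : StarModule K (LeavittPathAlgebra K E) where
  star_smul k x := by
    obtain ⟨a, rfl⟩ := mk_surjective x
    rw [← mk_smul, star_mk, star_mk, ← mk_smul, freeAdjoint_smul]

theorem star_mk_gen (g : Generator E) :
    star (mk (gen K g) : LeavittPathAlgebra K E) = mk (gen K g.adjoint) := by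
  rw [star_mk, freeAdjoint_gen]

end Involution

end

end LeavittPathAlgebra

/-!
A representation of `L_K(E)` by block matrices whose entries are generalized isometries shows that
no vertex vanishes; recording degrees by a Laurent variable turns it into a linear functional `φ`
on `L_K(E)` for which the paths ending at a given vertex are orthonormal. Hence `φ(b⋆ b)` is
`∑ k̄ k` over the coefficients of a combination `b` of such paths, and for these elements positive
definiteness is inherited from `K`.

In general, if `∑ aᵢ⋆ aᵢ = 0`, then `∑ (aᵢ e)⋆ (aᵢ e) = e⋆ (∑ aᵢ⋆ aᵢ) e = 0` for each edge `e`, and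
`aᵢ e` involves fewer ghost edges than `aᵢ`, so `aᵢ e = 0` by induction. If `a e = 0` for every `e`,
then `a v` is a combination of paths ending at `v`: for a regular vertex `v` it is zero by (CK2),
and at the other vertices the part of `a` made of ghost edges contributes nothing.
-/

noncomputable section

/-! ### Generalized isometries and block matrices -/

section Isometries

open Cardinal

variable (R : Type w) [Semiring R]

theorem exists_isometries {I X : Type v} [Nonempty I] [Infinite X] (hIX : #I ≤ #X) :
    ∃ S S' : I → Module.End R (X → R), (∀ i, S' i * S i = 1) ∧
      (∀ i j, i ≠ j → S' i * S j = 0) ∧ ∀ [Fintype I], ∑ i, S i * S' i = 1 := by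
  classical
  have hcard : #X = #(I × X) := by
    rw [mk_prod, lift_id, lift_id, mul_eq_right (aleph0_le_mk X) hIX (mk_ne_zero I)]
  obtain ⟨σ⟩ := Cardinal.eq.1 hcard
  let Θ : (X → R) ≃ₗ[R] (I → X → R) :=
    (LinearEquiv.funCongrLeft R R σ.symm).trans (LinearEquiv.curry R R I X)
  refine ⟨fun i => Θ.symm.toLinearMap ∘ₗ LinearMap.single R (fun _ : I => X → R) i,
    fun i => LinearMap.proj (φ := fun _ : I => X → R) i ∘ₗ Θ.toLinearMap,
    fun i => ?_, fun i j hij => ?_, fun {_} => ?_⟩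
  · ext1 f
    simp
  · ext1 f
    simp [Pi.single_eq_of_ne hij]
  · refine LinearMap.ext fun f => Θ.injective ?_
    simp [LinearMap.sum_apply, Finset.univ_sum_single]

theorem exists_isometries_on {I X : Type v} [Infinite X] (s : Set I) (hs : #s ≤ #X) :
    ∃ S S' : I → Module.End R (X → R), (∀ i ∈ s, S' i * S i = 1) ∧
      (∀ i ∈ s, ∀ j ∈ s, i ≠ j → S' i * S j = 0) ∧
      ∀ hfin : s.Finite, s.Nonempty → ∑ i ∈ hfin.toFinset, S i * S' i = 1 := by
  obtain rfl | hne := s.eq_empty_or_nonempty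
  · exact ⟨0, 0, by simp⟩
  have := hne.to_subtype
  obtain ⟨S, S', h_self, h_ne, h_sum⟩ := exists_isometries R hs
  have h_extend (T : s → Module.End R (X → R)) (i : s) :
      Function.extend Subtype.val T 0 i = T i := Subtype.val_injective.extend_apply T 0 i
  refine ⟨Function.extend Subtype.val S 0, Function.extend Subtype.val S' 0, ?_, ?_, ?_⟩
  · exact Subtype.forall'.2 fun i => by rw [h_extend, h_extend, h_self]
  · refine Subtype.forall'.2 fun i => Subtype.forall'.2 fun j hij => ?_
    rw [h_extend, h_extend, h_ne i j (Subtype.coe_ne_coe.1 hij)]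
  · intro hfin _
    rw [Finset.sum_subtype (F := hfin.fintype) _ fun i => hfin.mem_toFinset]
    simp only [h_extend, h_sum]

end Isometries

section MatrixUnits

variable {R ι W : Type*} [CommSemiring R] [AddCommMonoid W] [Module R W]

open Classical in
/-- The block matrix with entry `T` at the position `(i, j)` and zeros elsewhere, as an
endomorphism of `W^ι`. -/
def matrixUnit (i j : ι) : Module.End R W →ₗ[R] Module.End R (ι → W) where
  toFun T := LinearMap.single R (fun _ : ι => W) i ∘ₗ T ∘ₗ LinearMap.proj j
  map_add' S T := by rw [LinearMap.add_comp, LinearMap.comp_add]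
  map_smul' k T := by rw [LinearMap.smul_comp, LinearMap.comp_smul, RingHom.id_apply]

theorem matrixUnit_mul_matrixUnit (i j k : ι) (S T : Module.End R W) :
    matrixUnit i j S * matrixUnit j k T = matrixUnit i k (S * T) := by
  ext1 f
  simp [matrixUnit]

theorem matrixUnit_mul_matrixUnit_of_ne (i l : ι) {j k : ι} (h : j ≠ k) (S T : Module.End R W) :
    matrixUnit i j S * matrixUnit k l T = 0 := by
  ext1 f
  simp [matrixUnit, h]

theorem matrixUnit_injective (i j : ι) :
    Function.Injective (matrixUnit i j : Module.End R W →ₗ[R] Module.End R (ι → W)) := by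
  classical
  refine fun S T h => LinearMap.ext fun x => ?_
  simpa [matrixUnit] using congrFun (LinearMap.congr_fun h (Pi.single j x)) i

end MatrixUnits

end

/-! ### Leavitt families -/

/-- A family of elements of a ring satisfying the defining relations of the Leavitt path algebras
of `E`. Homomorphisms from `L_K(E)` to a `K`-algebra correspond to such families. -/
structure LeavittFamily (E : DirectedGraph.{u, v}) (A : Type*) [NonUnitalRing A] where
  /-- The projections `v`. -/
  vertex : E.Vertex → A
  /-- The elements `e`. -/
  edge : E.Edge → A
  /-- The elements `e⋆`. -/
  ghost : E.Edge → A
  vertex_mul_self : ∀ y, vertex y * vertex y = vertex y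
  vertex_mul_of_ne : ∀ y z, y ≠ z → vertex y * vertex z = 0
  source_mul_edge : ∀ e, vertex (E.source e) * edge e = edge e
  edge_mul_range : ∀ e, edge e * vertex (E.range e) = edge e
  range_mul_ghost : ∀ e, vertex (E.range e) * ghost e = ghost e
  ghost_mul_source : ∀ e, ghost e * vertex (E.source e) = ghost e
  ghost_mul_edge_self : ∀ e, ghost e * edge e = vertex (E.range e)
  ghost_mul_edge_of_ne : ∀ e f, e ≠ f → ghost e * edge f = 0
  vertex_eq_sum : ∀ (y : E.Vertex) (hfin : {e : E.Edge | E.source e = y}.Finite),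
    {e : E.Edge | E.source e = y}.Nonempty → vertex y = ∑ e ∈ hfin.toFinset, edge e * ghost e

namespace LeavittFamily

open LeavittPath

noncomputable section

section Lift

variable {K : Type w} [Field K] {E : DirectedGraph.{u, v}} {A : Type*} [NonUnitalRing A]

/-- The element of a Leavitt family that corresponds to a generator of `L_K(E)`. -/
def ofGenerator (F : LeavittFamily E A) : Generator E → A
  | .vertex y => F.vertex y
  | .edge e => F.edge e
  | .ghost e => F.ghost e

variable [Module K A] [IsScalarTower K A A] [SMulCommClass K A A]

variable (K) in
/-- The homomorphism from the free algebra determined by a Leavitt family. -/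
def freeLift (F : LeavittFamily E A) : FreeAlg K E →ₙₐ[K] A :=
  MonoidAlgebra.liftMagma K (FreeSemigroup.lift F.ofGenerator)

theorem freeLift_gen (F : LeavittFamily E A) (g : Generator E) :
    F.freeLift K (gen K g) = F.ofGenerator g := by
  simp [freeLift, gen]

theorem freeLift_eq_of_rel (F : LeavittFamily E A) {a b : FreeAlg K E} (h : Rel K a b) :
    F.freeLift K a = F.freeLift K b := by
  cases h <;> simp only [map_mul, map_zero, map_sum, freeLift_gen, ofGenerator]
  · exact F.vertex_mul_self _
  · exact F.vertex_mul_of_ne _ _ ‹_›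
  · exact F.source_mul_edge _
  · exact F.edge_mul_range _
  · exact F.range_mul_ghost _
  · exact F.ghost_mul_source _
  · exact F.ghost_mul_edge_self _
  · exact F.ghost_mul_edge_of_ne _ _ ‹_›
  · exact F.vertex_eq_sum _ _ ‹_›

theorem freeLift_eq_of_con (F : LeavittFamily E A) {a b : FreeAlg K E} (h : con K E a b) :
    F.freeLift K a = F.freeLift K b := by
  let c : RingCon (FreeAlg K E) :=
    { r := fun a b => F.freeLift K a = F.freeLift K b
      iseqv := ⟨fun _ => rfl, Eq.symm, Eq.trans⟩
      add' := fun h h' => by simp only [map_add, h, h']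
      mul' := fun h h' => by simp only [map_mul, h, h'] }
  have hc : IsAdmissible K c :=
    ⟨fun k a b (hab : F.freeLift K a = F.freeLift K b) =>
      show F.freeLift K (k • a) = F.freeLift K (k • b) by rw [map_smul, map_smul, hab],
      fun _ _ => F.freeLift_eq_of_rel⟩
  exact h c hc

variable (K) in
/-- The homomorphism from the Leavitt path algebra determined by a Leavitt family. -/
def lift (F : LeavittFamily E A) : LeavittPathAlgebra K E →ₙₐ[K] A where
  toFun := Quotient.lift (F.freeLift K) fun _ _ => F.freeLift_eq_of_con
  map_smul' k := (LeavittPathAlgebra.mk_surjective.forall).2 (map_smul (F.freeLift K) k)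
  map_zero' := map_zero (F.freeLift K)
  map_add' := (LeavittPathAlgebra.mk_surjective.forall₂).2 (map_add (F.freeLift K))
  map_mul' := (LeavittPathAlgebra.mk_surjective.forall₂).2 (map_mul (F.freeLift K))

theorem lift_mk_gen (F : LeavittFamily E A) (g : Generator E) :
    F.lift K (LeavittPathAlgebra.mk (gen K g)) = F.ofGenerator g :=
  F.freeLift_gen g

end Lift

section Laurent

open LaurentPolynomial

variable {E : DirectedGraph.{u, v}} {A : Type*} [Ring A]

/-- The family `v, eT, e⋆T⁻¹`, which records the degree of a monomial `p q⋆` as the exponent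
of `T`. -/
def laurent (F : LeavittFamily E A) : LeavittFamily E A[T;T⁻¹] where
  vertex y := .single 0 (F.vertex y)
  edge e := .single 1 (F.edge e)
  ghost e := .single (-1) (F.ghost e)
  vertex_mul_self y := by
    rw [AddMonoidAlgebra.single_mul_single, F.vertex_mul_self, add_zero]
  vertex_mul_of_ne y z h := by
    rw [AddMonoidAlgebra.single_mul_single, F.vertex_mul_of_ne y z h, AddMonoidAlgebra.single_zero]
  source_mul_edge e := by
    rw [AddMonoidAlgebra.single_mul_single, F.source_mul_edge, zero_add]
  edge_mul_range e := by
    rw [AddMonoidAlgebra.single_mul_single, F.edge_mul_range, add_zero]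
  range_mul_ghost e := by
    rw [AddMonoidAlgebra.single_mul_single, F.range_mul_ghost, zero_add]
  ghost_mul_source e := by
    rw [AddMonoidAlgebra.single_mul_single, F.ghost_mul_source, add_zero]
  ghost_mul_edge_self e := by
    rw [AddMonoidAlgebra.single_mul_single, F.ghost_mul_edge_self, neg_add_cancel]
  ghost_mul_edge_of_ne e f h := by
    rw [AddMonoidAlgebra.single_mul_single, F.ghost_mul_edge_of_ne e f h,
      AddMonoidAlgebra.single_zero]
  vertex_eq_sum y hfin hne := by
    simp only [AddMonoidAlgebra.single_mul_single, add_neg_cancel, F.vertex_eq_sum y hfin hne]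
    exact map_sum (AddMonoidAlgebra.singleAddHom 0) _ _

end Laurent

section Existence

open Cardinal

theorem exists_vertex_ne_zero (K : Type w) [Field K] (E : DirectedGraph.{u, v}) :
    ∃ (A : Type (max u v w)) (_ : Ring A) (_ : Algebra K A) (F : LeavittFamily E A),
      ∀ y, F.vertex y ≠ 0 := by
  have hcard (y : E.Vertex) : #{e : E.Edge | E.source e = y} ≤ #(E.Edge ⊕ ℕ) :=
    mk_le_of_injective (Sum.inl_injective.comp Subtype.val_injective)
  choose S S' h_self h_ne h_sum using
    fun y : E.Vertex => exists_isometries_on K {e : E.Edge | E.source e = y} (hcard y)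
  let F : LeavittFamily E (Module.End K (E.Vertex → E.Edge ⊕ ℕ → K)) :=
    { vertex y := matrixUnit y y 1
      edge e := matrixUnit (E.source e) (E.range e) (S (E.source e) e)
      ghost e := matrixUnit (E.range e) (E.source e) (S' (E.source e) e)
      vertex_mul_self y := by rw [matrixUnit_mul_matrixUnit, one_mul]
      vertex_mul_of_ne y z h := matrixUnit_mul_matrixUnit_of_ne y z h 1 1
      source_mul_edge e := by rw [matrixUnit_mul_matrixUnit, one_mul]
      edge_mul_range e := by rw [matrixUnit_mul_matrixUnit, mul_one]
      range_mul_ghost e := by rw [matrixUnit_mul_matrixUnit, one_mul]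
      ghost_mul_source e := by rw [matrixUnit_mul_matrixUnit, mul_one]
      ghost_mul_edge_self e := by rw [matrixUnit_mul_matrixUnit, h_self _ e rfl]
      ghost_mul_edge_of_ne e f hef := by
        by_cases hs : E.source e = E.source f
        · rw [← hs, matrixUnit_mul_matrixUnit, h_ne _ e rfl f hs.symm hef, map_zero]
        · exact matrixUnit_mul_matrixUnit_of_ne _ _ hs _ _
      vertex_eq_sum y hfin hne := by
        rw [← h_sum y hfin hne, map_sum]
        refine Finset.sum_congr rfl fun e he => ?_
        obtain rfl : E.source e = y := hfin.mem_toFinset.1 he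
        rw [matrixUnit_mul_matrixUnit] }
  exact ⟨_, inferInstance, inferInstance, F, fun y =>
    ((matrixUnit_injective y y).ne_iff' (map_zero _)).2 one_ne_zero⟩

end Existence

end

end LeavittFamily

/-! ### Right units and sums of squares -/

section RightUnits

open Filter

variable (R : Type*) {A ι : Type*} [Semiring R] [NonUnitalSemiring A] [Module R A]
  [IsScalarTower R A A]

/-- The left ideal of the elements for which the net `u` is eventually a right unit. -/
def rightUnitIdeal (u : Finset ι → A) : Submodule R A where
  carrier := {a | ∀ᶠ s in atTop, a * u s = a}
  zero_mem' := .of_forall fun s => zero_mul (u s)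
  add_mem' ha hb := by
    filter_upwards [ha, hb] with s ha hb
    rw [add_mul, ha, hb]
  smul_mem' k a ha := by
    filter_upwards [ha] with s ha
    rw [smul_mul_assoc, ha]

variable {R}

theorem mul_mem_rightUnitIdeal {u : Finset ι → A} (a : A) {b : A} (hb : b ∈ rightUnitIdeal R u) :
    a * b ∈ rightUnitIdeal R u := by
  filter_upwards [hb] with s hb
  rw [mul_assoc, hb]

theorem mem_rightUnitIdeal_sum {p : ι → A} {a : A} {i : ι} (hself : a * p i = a)
    (hne : ∀ j, j ≠ i → a * p j = 0) :
    a ∈ rightUnitIdeal R fun s => ∑ j ∈ s, p j := by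
  filter_upwards [eventually_ge_atTop {i}] with s hs
  rw [Finset.mul_sum, Finset.sum_eq_single_of_mem i (Finset.singleton_subset_iff.1 hs)
    fun j _ hj => hne j hj, hself]

end RightUnits

theorem IsPositiveDefinite.eq_zero_of_sum_eq_zero {R ι : Type*} [NonUnitalRing R] [StarRing R]
    (hR : IsPositiveDefinite R) {s : Finset ι} {x : ι → R}
    (hx : ∑ i ∈ s, star (x i) * x i = 0) : ∀ i ∈ s, x i = 0 := by
  intro i hi
  have hcard : 0 < s.card := Finset.card_pos.2 ⟨i, hi⟩
  have hsum : ∑ j, star (x (s.equivFin.symm j)) * x (s.equivFin.symm j) = 0 := by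
    rw [s.equivFin.symm.sum_comp fun i : s => star (x i) * x i,
      Finset.sum_coe_sort s fun i => star (x i) * x i, hx]
  simpa using hR s.card hcard _ hsum (s.equivFin ⟨i, hi⟩)

theorem sum_star_mul_mul_self_eq_zero {R ι : Type*} [NonUnitalRing R] [StarRing R] {s : Finset ι}
    {a : ι → R} (ha : ∑ i ∈ s, star (a i) * a i = 0) (x : R) :
    ∑ i ∈ s, star (a i * x) * (a i * x) = 0 := by
  simp only [star_mul, mul_assoc, ← Finset.mul_sum]
  simp only [← mul_assoc (star _) (_ : R) x, ← Finset.sum_mul, ha, zero_mul, mul_zero]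

/-! ### Paths in the Leavitt path algebra -/

namespace LeavittPathAlgebra

open LeavittPath Submodule
open Filter (Eventually atTop eventually_all eventually_ge_atTop)

noncomputable section

variable (K : Type w) [Field K] {E : DirectedGraph.{u, v}}

/-- A vertex as an element of the Leavitt path algebra. -/
def ofVertex (y : E.Vertex) : LeavittPathAlgebra K E := mk (vtx K y)

/-- An edge as an element of the Leavitt path algebra. -/
def ofEdge (e : E.Edge) : LeavittPathAlgebra K E := mk (edg K e)

/-- A ghost edge `e⋆` as an element of the Leavitt path algebra. -/
def ofGhost (e : E.Edge) : LeavittPathAlgebra K E := mk (gho K e)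

variable {K}

theorem mk_eq_of_rel {a b : FreeAlg K E} (h : Rel K a b) :
    (mk a : LeavittPathAlgebra K E) = mk b :=
  mk_eq_mk.2 ((con_isAdmissible K).2 a b h)

theorem ofVertex_mul_self (y : E.Vertex) : ofVertex K y * ofVertex K y = ofVertex K y :=
  mk_eq_of_rel (.vertex_self y)

theorem ofVertex_mul_of_ne {y z : E.Vertex} (h : y ≠ z) : ofVertex K y * ofVertex K z = 0 :=
  mk_eq_of_rel (.vertex_ne y z h)

theorem source_mul_ofEdge (e : E.Edge) : ofVertex K (E.source e) * ofEdge K e = ofEdge K e :=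
  mk_eq_of_rel (.source_edge e)

theorem ofEdge_mul_range (e : E.Edge) : ofEdge K e * ofVertex K (E.range e) = ofEdge K e :=
  mk_eq_of_rel (.edge_range e)

theorem range_mul_ofGhost (e : E.Edge) : ofVertex K (E.range e) * ofGhost K e = ofGhost K e :=
  mk_eq_of_rel (.range_ghost e)

theorem ofGhost_mul_source (e : E.Edge) : ofGhost K e * ofVertex K (E.source e) = ofGhost K e :=
  mk_eq_of_rel (.ghost_source e)

theorem ofGhost_mul_ofEdge_self (e : E.Edge) :
    ofGhost K e * ofEdge K e = ofVertex K (E.range e) :=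
  mk_eq_of_rel (.ck1_self e)

theorem ofGhost_mul_ofEdge_of_ne {e f : E.Edge} (h : e ≠ f) : ofGhost K e * ofEdge K f = 0 :=
  mk_eq_of_rel (.ck1_ne e f h)

theorem ofVertex_eq_sum (y : E.Vertex) (hfin : {e : E.Edge | E.source e = y}.Finite)
    (hne : {e : E.Edge | E.source e = y}.Nonempty) :
    ofVertex K y = ∑ e ∈ hfin.toFinset, ofEdge K e * ofGhost K e :=
  (mk_eq_of_rel (.ck2 y hfin hne)).trans
    (map_sum (AddMonoidHom.mk' (mk : FreeAlg K E → LeavittPathAlgebra K E) mk_add) _ _)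

theorem ofVertex_mul_ofEdge_of_ne {y : E.Vertex} {e : E.Edge} (h : y ≠ E.source e) :
    ofVertex K y * ofEdge K e = 0 := by
  rw [← source_mul_ofEdge, ← mul_assoc, ofVertex_mul_of_ne h, zero_mul]

theorem ofEdge_mul_ofVertex_of_ne {y : E.Vertex} {e : E.Edge} (h : E.range e ≠ y) :
    ofEdge K e * ofVertex K y = 0 := by
  rw [← ofEdge_mul_range, mul_assoc, ofVertex_mul_of_ne h, mul_zero]

theorem ofGhost_mul_ofVertex_of_ne {y : E.Vertex} {e : E.Edge} (h : E.source e ≠ y) :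
    ofGhost K e * ofVertex K y = 0 := by
  rw [← ofGhost_mul_source, mul_assoc, ofVertex_mul_of_ne h, mul_zero]

section Involution

variable [StarRing K]

theorem star_ofVertex (y : E.Vertex) : star (ofVertex K y) = ofVertex K y := star_mk_gen _

theorem star_ofEdge (e : E.Edge) : star (ofEdge K e) = ofGhost K e := star_mk_gen _

end Involution

section Paths

variable (K) in
/-- The element `e₁ ⋯ eₘ y` for a list of edges and a vertex `y`. It is zero unless the edges form
a path ending at `y`, so that no separate type of paths is needed. -/
def ofPath (y : E.Vertex) : List E.Edge → LeavittPathAlgebra K E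
  | [] => ofVertex K y
  | e :: l => ofEdge K e * ofPath y l

variable (K) in
/-- The adjoint `y eₘ⋆ ⋯ e₁⋆` of `ofPath`, defined without an involution on `K`. -/
def ofGhostPath (y : E.Vertex) : List E.Edge → LeavittPathAlgebra K E
  | [] => ofVertex K y
  | e :: l => ofGhostPath y l * ofGhost K e

theorem star_ofPath [StarRing K] (y : E.Vertex) (l : List E.Edge) :
    star (ofPath K y l) = ofGhostPath K y l := by
  induction l with
  | nil => exact star_ofVertex y
  | cons e l ih => rw [ofPath, star_mul, ih, star_ofEdge, ofGhostPath]

theorem ofPath_mul_ofVertex (y : E.Vertex) (l : List E.Edge) :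
    ofPath K y l * ofVertex K y = ofPath K y l := by
  induction l with
  | nil => exact ofVertex_mul_self y
  | cons e l ih => rw [ofPath, mul_assoc, ih]

theorem ofPath_concat (e : E.Edge) (l : List E.Edge) :
    ofPath K (E.range e) (l ++ [e]) = ofPath K (E.source e) l * ofEdge K e := by
  induction l with
  | nil => exact (ofEdge_mul_range e).trans (source_mul_ofEdge e).symm
  | cons f l ih => rw [List.cons_append, ofPath, ih, ofPath, mul_assoc]

theorem ofGhostPath_concat (e : E.Edge) (l : List E.Edge) :
    ofGhostPath K (E.range e) (l ++ [e]) = ofGhost K e * ofGhostPath K (E.source e) l := by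
  induction l with
  | nil => exact (range_mul_ofGhost e).trans (ofGhost_mul_source e).symm
  | cons f l ih => rw [List.cons_append, ofGhostPath, ih, ofGhostPath, mul_assoc]

theorem ofVertex_mul_ofPath (x y : E.Vertex) (l : List E.Edge) :
    ofVertex K x * ofPath K y l = ofPath K y l ∨ ofVertex K x * ofPath K y l = 0 := by
  cases l with
  | nil =>
    obtain rfl | h := eq_or_ne x y
    · exact .inl (ofVertex_mul_self x)
    · exact .inr (ofVertex_mul_of_ne h)
  | cons e l =>
    rw [ofPath, ← mul_assoc]
    obtain rfl | h := eq_or_ne x (E.source e)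
    · exact .inl (by rw [source_mul_ofEdge])
    · exact .inr (by rw [ofVertex_mul_ofEdge_of_ne h, zero_mul])

theorem ofGhostPath_mul_ofPath_self (y : E.Vertex) (l : List E.Edge) :
    ofPath K y l = 0 ∨ ofGhostPath K y l * ofPath K y l = ofVertex K y := by
  induction l with
  | nil => exact .inr (ofVertex_mul_self y)
  | cons e l ih =>
    rw [ofPath, ofGhostPath, mul_assoc, ← mul_assoc (ofGhost K e), ofGhost_mul_ofEdge_self]
    obtain h | h := ih
    · exact .inl (by rw [h, mul_zero])
    obtain h' | h' := ofVertex_mul_ofPath (K := K) (E.range e) y l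
    · exact .inr (by rw [h', h])
    · exact .inl (by rw [← ofEdge_mul_range, mul_assoc, h', mul_zero])

theorem ofGhostPath_mul_ofPath_of_length_eq (y : E.Vertex) {l l' : List E.Edge}
    (hlen : l.length = l'.length) (hne : l ≠ l') : ofGhostPath K y l * ofPath K y l' = 0 := by
  induction l generalizing l' with
  | nil => exact absurd (List.length_eq_zero_iff.1 hlen.symm).symm hne
  | cons e l ih =>
    obtain _ | ⟨f, l'⟩ := l'
    · simp at hlen
    rw [ofPath, ofGhostPath, mul_assoc, ← mul_assoc (ofGhost K e)]
    obtain rfl | hef := eq_or_ne e f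
    · rw [ofGhost_mul_ofEdge_self]
      obtain h | h := ofVertex_mul_ofPath (K := K) (E.range e) y l'
      · rw [h, ih (by simpa using hlen) (by simpa using hne)]
      · rw [h, mul_zero]
    · rw [ofGhost_mul_ofEdge_of_ne hef, zero_mul, mul_zero]

end Paths

/-! ### Orthonormality of paths -/

section PathFunctional

/-- A linear functional `φ` for which the nonzero paths ending at `y` are orthonormal with respect
to the form `(a, b) ↦ φ(a⋆ b)`. -/
def IsPathFunctional (y : E.Vertex) (φ : LeavittPathAlgebra K E →ₗ[K] K) : Prop :=
  φ (ofVertex K y) = 1 ∧ ∀ l l', l ≠ l' → φ (ofGhostPath K y l * ofPath K y l') = 0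

theorem lift_laurent_ofPath {A : Type*} [Ring A] [Algebra K A] (F : LeavittFamily E A)
    (y : E.Vertex) (l : List E.Edge) :
    ∃ a, F.laurent.lift K (ofPath K y l) = .single (l.length : ℤ) a := by
  induction l with
  | nil => exact ⟨_, F.laurent.lift_mk_gen _⟩
  | cons e l ih =>
    obtain ⟨a, ha⟩ := ih
    refine ⟨F.edge e * a, ?_⟩
    rw [ofPath, map_mul, ha, ofEdge, F.laurent.lift_mk_gen]
    simp only [LeavittFamily.ofGenerator, LeavittFamily.laurent,
      AddMonoidAlgebra.single_mul_single, List.length_cons, Nat.cast_succ, add_comm]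

theorem lift_laurent_ofGhostPath {A : Type*} [Ring A] [Algebra K A] (F : LeavittFamily E A)
    (y : E.Vertex) (l : List E.Edge) :
    ∃ a, F.laurent.lift K (ofGhostPath K y l) = .single (-l.length : ℤ) a := by
  induction l with
  | nil => exact ⟨_, F.laurent.lift_mk_gen _⟩
  | cons e l ih =>
    obtain ⟨a, ha⟩ := ih
    refine ⟨a * F.ghost e, ?_⟩
    rw [ofGhostPath, map_mul, ha, ofGhost, F.laurent.lift_mk_gen]
    simp only [LeavittFamily.ofGenerator, LeavittFamily.laurent,
      AddMonoidAlgebra.single_mul_single, List.length_cons, Nat.cast_succ, neg_add]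

theorem exists_isPathFunctional (y : E.Vertex) :
    ∃ φ : LeavittPathAlgebra K E →ₗ[K] K, IsPathFunctional y φ := by
  obtain ⟨A, _, _, F, hF⟩ := LeavittFamily.exists_vertex_ne_zero K E
  obtain ⟨ψ, hψ⟩ := Module.Projective.exists_dual_eq_one K (hF y)
  let degreeZero : LaurentPolynomial A →ₗ[K] A :=
    Finsupp.lapply 0 ∘ₗ (AddMonoidAlgebra.coeffLinearEquiv K).toLinearMap
  have degreeZero_single (n : ℤ) (a : A) :
      degreeZero (.single n a) = if n = 0 then a else 0 := by
    simp [degreeZero, Finsupp.single_apply, - LaurentPolynomial.single_eq_C_mul_T]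
  refine ⟨ψ ∘ₗ degreeZero ∘ₗ (F.laurent.lift K : _ →ₗ[K] LaurentPolynomial A), ?_,
    fun l l' hne => ?_⟩
  · have hvertex : F.laurent.lift K (ofVertex K y) = .single 0 (F.vertex y) :=
      F.laurent.lift_mk_gen _
    simp [hvertex, degreeZero_single, hψ, - LaurentPolynomial.single_eq_C_mul_T]
  · by_cases hlen : l.length = l'.length
    · rw [ofGhostPath_mul_ofPath_of_length_eq y hlen hne, map_zero]
    obtain ⟨a, ha⟩ := lift_laurent_ofGhostPath (K := K) F y l
    obtain ⟨b, hb⟩ := lift_laurent_ofPath (K := K) F y l'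
    have hdeg : (-l.length + l'.length : ℤ) ≠ 0 := by omega
    simp [ha, hb, AddMonoidAlgebra.single_mul_single, degreeZero_single, hdeg,
      - LaurentPolynomial.single_eq_C_mul_T]

theorem IsPathFunctional.comp_edge {e : E.Edge} {φ : LeavittPathAlgebra K E →ₗ[K] K}
    (hφ : IsPathFunctional (E.range e) φ) :
    IsPathFunctional (E.source e)
      (φ ∘ₗ LinearMap.mulLeft K (ofGhost K e) ∘ₗ LinearMap.mulRight K (ofEdge K e)) := by
  refine ⟨?_, fun l l' hne => ?_⟩
  · simp only [LinearMap.comp_apply, LinearMap.mulLeft_apply, LinearMap.mulRight_apply,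
      source_mul_ofEdge, ofGhost_mul_ofEdge_self, hφ.1]
  · have := hφ.2 (l ++ [e]) (l' ++ [e]) (by simpa using hne)
    simpa only [ofGhostPath_concat, ofPath_concat, LinearMap.comp_apply, LinearMap.mulLeft_apply,
      LinearMap.mulRight_apply, mul_assoc] using this

end PathFunctional
section PathSpan

variable (K) in
/-- The span of the paths ending at `y`. -/
def pathSpan (y : E.Vertex) : Submodule K (LeavittPathAlgebra K E) :=
  span K (Set.range (ofPath K y))

theorem ofPath_mem_pathSpan (y : E.Vertex) (l : List E.Edge) : ofPath K y l ∈ pathSpan K y :=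
  subset_span ⟨l, rfl⟩

theorem eventually_sum_coord_smul_ofPath {y : E.Vertex} {φ : LeavittPathAlgebra K E →ₗ[K] K}
    (hφ : IsPathFunctional y φ) {b : LeavittPathAlgebra K E} (hb : b ∈ pathSpan K y) :
    ∀ᶠ s : Finset (List E.Edge) in atTop,
      ∑ l ∈ s, φ (ofGhostPath K y l * b) • ofPath K y l = b := by
  induction hb using span_induction with
  | mem b hb =>
    obtain ⟨l, rfl⟩ := hb
    filter_upwards [eventually_ge_atTop {l}] with s hs
    rw [Finset.sum_eq_single_of_mem l (Finset.singleton_subset_iff.1 hs)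
      fun l' _ hne => by rw [hφ.2 l' l hne, zero_smul]]
    obtain h | h := ofGhostPath_mul_ofPath_self (K := K) y l
    · rw [h, smul_zero]
    · rw [h, hφ.1, one_smul]
  | zero => simp
  | add a b _ _ ha hb =>
    filter_upwards [ha, hb] with s ha hb
    simp only [mul_add, map_add, add_smul, Finset.sum_add_distrib, ha, hb]
  | smul k b _ hb =>
    filter_upwards [hb] with s hb
    simp only [mul_smul_comm, map_smul, smul_assoc, ← Finset.smul_sum, hb]

theorem eq_zero_of_mul_ofEdge_eq_zero {e : E.Edge} {b : LeavittPathAlgebra K E}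
    (hb : b ∈ pathSpan K (E.source e)) (hbe : b * ofEdge K e = 0) : b = 0 := by
  obtain ⟨φ, hφ⟩ := exists_isPathFunctional (K := K) (E.range e)
  obtain ⟨s, hs⟩ := (eventually_sum_coord_smul_ofPath hφ.comp_edge hb).exists
  rw [← hs]
  refine Finset.sum_eq_zero fun l _ => ?_
  rw [LinearMap.comp_apply, LinearMap.comp_apply, LinearMap.mulRight_apply, mul_assoc, hbe,
    mul_zero, map_zero, map_zero, zero_smul]

theorem eventually_apply_star_mul_self [StarRing K] {y : E.Vertex}
    {φ : LeavittPathAlgebra K E →ₗ[K] K} (hφ : IsPathFunctional y φ)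
    {b : LeavittPathAlgebra K E} (hb : b ∈ pathSpan K y) :
    ∀ᶠ s : Finset (List E.Edge) in atTop, φ (star b * b) =
      ∑ l ∈ s, star (φ (ofGhostPath K y l * b)) * φ (ofGhostPath K y l * b) := by
  filter_upwards [eventually_sum_coord_smul_ofPath hφ hb] with s hs
  calc φ (star b * b)
      = φ (star (∑ l ∈ s, φ (ofGhostPath K y l * b) • ofPath K y l) * b) := by rw [hs]
    _ = ∑ l ∈ s, star (φ (ofGhostPath K y l * b)) * φ (ofGhostPath K y l * b) := by
      simp only [star_sum, star_smul, star_ofPath, Finset.sum_mul, smul_mul_assoc, map_sum,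
        map_smul, smul_eq_mul]

variable (K E) in
/-- The span of all paths. -/
def allPathSpan : Submodule K (LeavittPathAlgebra K E) := ⨆ y, pathSpan K y

theorem ofPath_mem_allPathSpan (y : E.Vertex) (l : List E.Edge) :
    ofPath K y l ∈ allPathSpan K E :=
  le_iSup (pathSpan K) y (ofPath_mem_pathSpan y l)

theorem map_mem_of_mem_allPathSpan {S : Submodule K (LeavittPathAlgebra K E)}
    {f : LeavittPathAlgebra K E →ₗ[K] LeavittPathAlgebra K E} (hf : ∀ y l, f (ofPath K y l) ∈ S)
    {b : LeavittPathAlgebra K E} (hb : b ∈ allPathSpan K E) : f b ∈ S :=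
  (iSup_le fun y => span_le.2 (Set.range_subset_iff.2 (hf y)) : allPathSpan K E ≤ S.comap f) hb

theorem mul_ofVertex_mem_pathSpan {b : LeavittPathAlgebra K E} (hb : b ∈ allPathSpan K E)
    (y : E.Vertex) : b * ofVertex K y ∈ pathSpan K y := by
  refine map_mem_of_mem_allPathSpan (f := LinearMap.mulRight K (ofVertex K y)) (fun z l => ?_) hb
  rw [LinearMap.mulRight_apply]
  obtain rfl | h := eq_or_ne z y
  · rw [ofPath_mul_ofVertex]
    exact ofPath_mem_pathSpan z l
  · rw [← ofPath_mul_ofVertex, mul_assoc, ofVertex_mul_of_ne h, mul_zero]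
    exact zero_mem _

theorem mul_ofEdge_mem_allPathSpan {b : LeavittPathAlgebra K E} (hb : b ∈ allPathSpan K E)
    (e : E.Edge) : b * ofEdge K e ∈ allPathSpan K E := by
  refine map_mem_of_mem_allPathSpan (f := LinearMap.mulRight K (ofEdge K e)) (fun y l => ?_) hb
  rw [LinearMap.mulRight_apply]
  obtain rfl | h := eq_or_ne y (E.source e)
  · rw [← ofPath_concat]
    exact ofPath_mem_allPathSpan _ _
  · rw [← ofPath_mul_ofVertex, mul_assoc, ofVertex_mul_ofEdge_of_ne h, mul_zero]
    exact zero_mem _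

theorem ofVertex_mul_mem_allPathSpan {b : LeavittPathAlgebra K E} (hb : b ∈ allPathSpan K E)
    (x : E.Vertex) : ofVertex K x * b ∈ allPathSpan K E := by
  refine map_mem_of_mem_allPathSpan (f := LinearMap.mulLeft K (ofVertex K x)) (fun y l => ?_) hb
  rw [LinearMap.mulLeft_apply]
  obtain h | h := ofVertex_mul_ofPath (K := K) x y l <;> rw [h]
  · exact ofPath_mem_allPathSpan y l
  · exact zero_mem _

theorem ofEdge_mul_mem_allPathSpan {b : LeavittPathAlgebra K E} (hb : b ∈ allPathSpan K E)
    (e : E.Edge) : ofEdge K e * b ∈ allPathSpan K E :=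
  map_mem_of_mem_allPathSpan (f := LinearMap.mulLeft K (ofEdge K e))
    (fun y l => ofPath_mem_allPathSpan y (e :: l)) hb

theorem ofGhost_mul_mem_sup {b : LeavittPathAlgebra K E} (hb : b ∈ allPathSpan K E)
    (e : E.Edge) : ofGhost K e * b ∈ allPathSpan K E ⊔ K ∙ ofGhost K e := by
  refine map_mem_of_mem_allPathSpan (f := LinearMap.mulLeft K (ofGhost K e)) (fun y l => ?_) hb
  rw [LinearMap.mulLeft_apply]
  cases l with
  | nil =>
    obtain rfl | h := eq_or_ne (E.source e) y
    · rw [ofPath, ofGhost_mul_source]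
      exact mem_sup_right (mem_span_singleton_self _)
    · rw [ofPath, ofGhost_mul_ofVertex_of_ne h]
      exact zero_mem _
  | cons f l =>
    rw [ofPath, ← mul_assoc]
    obtain rfl | h := eq_or_ne e f
    · rw [ofGhost_mul_ofEdge_self]
      exact mem_sup_left (ofVertex_mul_mem_allPathSpan (ofPath_mem_allPathSpan y l) _)
    · rw [ofGhost_mul_ofEdge_of_ne h, zero_mul]
      exact zero_mem _

end PathSpan

section Generation

theorem eq_top_of_gen_mul_mem {S : Submodule K (LeavittPathAlgebra K E)}
    (hgen : ∀ g, mk (gen K g) ∈ S) (hmul : ∀ g, ∀ a ∈ S, mk (gen K g) * a ∈ S) : S = ⊤ := by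
  refine eq_top_iff'.2 (mk_surjective.forall.2 fun a => ?_)
  induction a using MonoidAlgebra.induction_linear with
  | zero => exact zero_mem S
  | add a b ha hb => exact add_mem ha hb
  | single p k =>
    rw [← mul_one k, ← smul_eq_mul, ← MonoidAlgebra.smul_single, mk_smul]
    refine smul_mem _ _ ?_
    induction p using FreeSemigroup.recOnMul with
    | ih1 g => exact hgen g
    | ih2 g p _ hp =>
      rw [← mul_one (1 : K), ← MonoidAlgebra.single_mul_single, mk_mul]
      exact hmul g _ hp

theorem rightUnitIdeal_sum_ofVertex :
    rightUnitIdeal K (fun s => ∑ y ∈ s, ofVertex K (E := E) y) = ⊤ := by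
  refine eq_top_of_gen_mul_mem (fun g => ?_) fun g a ha => mul_mem_rightUnitIdeal _ ha
  cases g with
  | vertex y =>
    exact mem_rightUnitIdeal_sum (ofVertex_mul_self y) fun z hz => ofVertex_mul_of_ne hz.symm
  | edge e =>
    exact mem_rightUnitIdeal_sum (ofEdge_mul_range e) fun z hz =>
      ofEdge_mul_ofVertex_of_ne hz.symm
  | ghost e =>
    exact mem_rightUnitIdeal_sum (ofGhost_mul_source e) fun z hz =>
      ofGhost_mul_ofVertex_of_ne hz.symm

theorem eq_zero_of_forall_mul_ofVertex_eq_zero {a : LeavittPathAlgebra K E}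
    (ha : ∀ y, a * ofVertex K y = 0) : a = 0 := by
  have hunit : a ∈ rightUnitIdeal K fun s => ∑ y ∈ s, ofVertex K (E := E) y := by
    rw [rightUnitIdeal_sum_ofVertex]
    exact mem_top
  obtain ⟨s, hs⟩ := Eventually.exists hunit
  rw [← hs, Finset.mul_sum, Finset.sum_eq_zero fun y _ => ha y]

variable (K E) in
/-- The left ideal generated by the ghost edges, for which the sums `∑ ee⋆` are right units. -/
def ghostIdeal : Submodule K (LeavittPathAlgebra K E) :=
  rightUnitIdeal K fun s => ∑ f ∈ s, ofEdge K f * ofGhost K f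

theorem ofGhost_mem_ghostIdeal (e : E.Edge) : ofGhost K e ∈ ghostIdeal K E := by
  refine mem_rightUnitIdeal_sum (i := e) ?_ fun f hf => ?_
  · rw [← mul_assoc, ofGhost_mul_ofEdge_self, range_mul_ofGhost]
  · rw [← mul_assoc, ofGhost_mul_ofEdge_of_ne hf.symm, zero_mul]

theorem ofVertex_mem_allPathSpan (y : E.Vertex) : ofVertex K y ∈ allPathSpan K E :=
  ofPath_mem_allPathSpan y []

theorem ofEdge_mem_allPathSpan (e : E.Edge) : ofEdge K e ∈ allPathSpan K E := by
  rw [← ofEdge_mul_range]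
  exact ofPath_mem_allPathSpan (E.range e) [e]

theorem allPathSpan_sup_ghostIdeal :
    allPathSpan K E ⊔ ghostIdeal K E = ⊤ := by
  refine eq_top_of_gen_mul_mem (fun g => ?_) fun g a ha => ?_
  · cases g with
    | vertex y => exact mem_sup_left (ofVertex_mem_allPathSpan y)
    | edge e => exact mem_sup_left (ofEdge_mem_allPathSpan e)
    | ghost e => exact mem_sup_right (ofGhost_mem_ghostIdeal e)
  · obtain ⟨b, hb, c, hc, rfl⟩ := mem_sup.1 ha
    rw [mul_add]
    refine add_mem ?_ (mem_sup_right (mul_mem_rightUnitIdeal _ hc))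
    cases g with
    | vertex y => exact mem_sup_left (ofVertex_mul_mem_allPathSpan hb y)
    | edge e => exact mem_sup_left (ofEdge_mul_mem_allPathSpan hb e)
    | ghost e =>
      have hle := (span_singleton_le_iff_mem _ _).2 (ofGhost_mem_ghostIdeal (K := K) e)
      exact sup_le_sup_left hle (allPathSpan K E) (ofGhost_mul_mem_sup hb e)

end Generation

section GhostFiltration

variable (K E) in
/-- The increasing filtration whose `n`-th term consists of the elements that turn into
combinations of paths when they are multiplied on the right by any `n` edges. -/
def ghostFiltration : ℕ → Submodule K (LeavittPathAlgebra K E)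
  | 0 => allPathSpan K E
  | n + 1 => ⨅ e, (ghostFiltration n).comap (LinearMap.mulRight K (ofEdge K e))

theorem mem_ghostFiltration_succ {n : ℕ} {a : LeavittPathAlgebra K E} :
    a ∈ ghostFiltration K E (n + 1) ↔ ∀ e, a * ofEdge K e ∈ ghostFiltration K E n := by
  simp only [ghostFiltration, mem_iInf, mem_comap, LinearMap.mulRight_apply]

theorem ghostFiltration_mono : Monotone (ghostFiltration K E) := by
  refine monotone_nat_of_le_succ fun n => ?_
  induction n with
  | zero => exact fun a ha => mem_ghostFiltration_succ.2 (mul_ofEdge_mem_allPathSpan ha)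
  | succ n ih =>
    exact fun a ha => mem_ghostFiltration_succ.2 fun e => ih (mem_ghostFiltration_succ.1 ha e)

theorem mul_mem_ghostFiltration {c : LeavittPathAlgebra K E}
    (hc : ∀ b ∈ allPathSpan K E, c * b ∈ allPathSpan K E) {n : ℕ} {a : LeavittPathAlgebra K E}
    (ha : a ∈ ghostFiltration K E n) : c * a ∈ ghostFiltration K E n := by
  induction n generalizing a with
  | zero => exact hc a ha
  | succ n ih =>
    refine mem_ghostFiltration_succ.2 fun e => ?_
    rw [mul_assoc]
    exact ih (mem_ghostFiltration_succ.1 ha e)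

theorem ofGhost_mem_ghostFiltration_one (e : E.Edge) : ofGhost K e ∈ ghostFiltration K E 1 := by
  refine mem_ghostFiltration_succ.2 fun f => ?_
  obtain rfl | h := eq_or_ne e f
  · rw [ofGhost_mul_ofEdge_self]
    exact ofVertex_mem_allPathSpan _
  · rw [ofGhost_mul_ofEdge_of_ne h]
    exact zero_mem _

theorem ofGhost_mul_mem_ghostFiltration (e : E.Edge) {n : ℕ} {a : LeavittPathAlgebra K E}
    (ha : a ∈ ghostFiltration K E n) : ofGhost K e * a ∈ ghostFiltration K E (n + 1) := by
  induction n generalizing a with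
  | zero =>
    have hle : allPathSpan K E ⊔ K ∙ ofGhost K e ≤ ghostFiltration K E 1 :=
      sup_le (ghostFiltration_mono zero_le_one)
        ((span_singleton_le_iff_mem _ _).2 (ofGhost_mem_ghostFiltration_one e))
    exact hle (ofGhost_mul_mem_sup ha e)
  | succ n ih =>
    refine mem_ghostFiltration_succ.2 fun f => ?_
    rw [mul_assoc]
    exact ih (mem_ghostFiltration_succ.1 ha f)

theorem iSup_ghostFiltration : ⨆ n, ghostFiltration K E n = ⊤ := by
  refine eq_top_of_gen_mul_mem (fun g => ?_) fun g a ha => ?_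
  · cases g with
    | vertex y => exact mem_iSup_of_mem 0 (ofVertex_mem_allPathSpan y)
    | edge e => exact mem_iSup_of_mem 0 (ofEdge_mem_allPathSpan e)
    | ghost e => exact mem_iSup_of_mem 1 (ofGhost_mem_ghostFiltration_one e)
  · obtain ⟨n, ha⟩ := (mem_iSup_of_directed _ ghostFiltration_mono.directed_le).1 ha
    cases g with
    | vertex y =>
      exact mem_iSup_of_mem n
        (mul_mem_ghostFiltration (fun _ hb => ofVertex_mul_mem_allPathSpan hb y) ha)
    | edge e =>
      exact mem_iSup_of_mem n
        (mul_mem_ghostFiltration (fun _ hb => ofEdge_mul_mem_allPathSpan hb e) ha)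
    | ghost e => exact mem_iSup_of_mem (n + 1) (ofGhost_mul_mem_ghostFiltration e ha)

theorem exists_forall_mem_ghostFiltration {ι : Type*} [Finite ι]
    (a : ι → LeavittPathAlgebra K E) : ∃ n, ∀ i, a i ∈ ghostFiltration K E n := by
  have hexists (i : ι) : ∃ n, a i ∈ ghostFiltration K E n := by
    rw [← mem_iSup_of_directed _ ghostFiltration_mono.directed_le, iSup_ghostFiltration]
    exact mem_top
  choose n hn using hexists
  obtain ⟨N, hN⟩ := (Set.finite_range n).bddAbove
  exact ⟨N, fun i => ghostFiltration_mono (hN ⟨i, rfl⟩) (hn i)⟩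

end GhostFiltration

/-! ### Reduction to combinations of paths -/

section Reduction

theorem mul_ofVertex_eq_zero_of_mem_ghostIdeal {c : LeavittPathAlgebra K E}
    (hc : c ∈ ghostIdeal K E) {y : E.Vertex} (hcy : ∀ e, E.source e = y → c * ofEdge K e = 0) :
    c * ofVertex K y = 0 := by
  obtain ⟨s, hs⟩ := Eventually.exists hc
  rw [← hs, mul_assoc, Finset.sum_mul, Finset.mul_sum]
  refine Finset.sum_eq_zero fun e _ => ?_
  obtain h | h := eq_or_ne (E.source e) y
  · rw [← mul_assoc, ← mul_assoc, hcy e h, zero_mul, zero_mul]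
  · rw [mul_assoc, ofGhost_mul_ofVertex_of_ne h, mul_zero, mul_zero]

theorem exists_mul_ofEdge_eq_zero_of_mem_ghostIdeal {c : LeavittPathAlgebra K E}
    (hc : c ∈ ghostIdeal K E) {y : E.Vertex} (hy : {e : E.Edge | E.source e = y}.Infinite) :
    ∃ e, E.source e = y ∧ c * ofEdge K e = 0 := by
  obtain ⟨s, hs⟩ := Eventually.exists hc
  obtain ⟨e, hey, hes⟩ := hy.exists_notMem_finset s
  refine ⟨e, hey, ?_⟩
  rw [← hs, mul_assoc, Finset.sum_mul, Finset.sum_eq_zero, mul_zero]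
  intro f hf
  rw [mul_assoc, ofGhost_mul_ofEdge_of_ne (ne_of_mem_of_not_mem hf hes), mul_zero]

theorem mul_ofEdge_eq_zero_of_mul_ofEdge_eq_zero {b : LeavittPathAlgebra K E}
    (hb : b ∈ allPathSpan K E) {e f : E.Edge} (hef : E.source e = E.source f)
    (hbe : b * ofEdge K e = 0) : b * ofEdge K f = 0 := by
  have hbs : b * ofVertex K (E.source e) = 0 := by
    refine eq_zero_of_mul_ofEdge_eq_zero (mul_ofVertex_mem_pathSpan hb _) ?_
    rw [mul_assoc, source_mul_ofEdge, hbe]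
  rw [← source_mul_ofEdge, ← mul_assoc, ← hef, hbs, zero_mul]

theorem mul_ofVertex_mem_pathSpan_of_forall_mul_ofEdge_eq_zero {a : LeavittPathAlgebra K E}
    (ha : ∀ e, a * ofEdge K e = 0) (y : E.Vertex) : a * ofVertex K y ∈ pathSpan K y := by
  by_cases hy : {e : E.Edge | E.source e = y}.Finite ∧ {e : E.Edge | E.source e = y}.Nonempty
  · have hzero : a * ofVertex K y = 0 := by
      rw [ofVertex_eq_sum y hy.1 hy.2, Finset.mul_sum]
      exact Finset.sum_eq_zero fun e _ => by rw [← mul_assoc, ha, zero_mul]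
    exact hzero ▸ zero_mem _
  obtain ⟨b, hb, c, hc, rfl⟩ := mem_sup.1
    (allPathSpan_sup_ghostIdeal (K := K) (E := E) ▸ mem_top : a ∈ allPathSpan K E ⊔ ghostIdeal K E)
  have hbc (e : E.Edge) : b * ofEdge K e + c * ofEdge K e = 0 := (add_mul b c _).symm.trans (ha e)
  have hcy : ∀ e, E.source e = y → c * ofEdge K e = 0 := by
    rintro e rfl
    obtain ⟨f, hf, hcf⟩ := exists_mul_ofEdge_eq_zero_of_mem_ghostIdeal hc
      fun hfin => hy ⟨hfin, e, rfl⟩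
    have hbf : b * ofEdge K f = 0 := by rw [← hbc f, hcf, add_zero]
    rw [← hbc e, mul_ofEdge_eq_zero_of_mul_ofEdge_eq_zero hb hf hbf, zero_add]
  rw [add_mul, mul_ofVertex_eq_zero_of_mem_ghostIdeal hc hcy, add_zero]
  exact mul_ofVertex_mem_pathSpan hb y

end Reduction

section PositiveDefinite

variable [StarRing K] {ι : Type*} [Fintype ι] {a : ι → LeavittPathAlgebra K E}

theorem eq_zero_of_mem_pathSpan (hK : IsPositiveDefinite K) {y : E.Vertex}
    (hmem : ∀ i, a i ∈ pathSpan K y) (ha : ∑ i, star (a i) * a i = 0) (i : ι) : a i = 0 := by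
  obtain ⟨φ, hφ⟩ := exists_isPathFunctional (K := K) y
  obtain ⟨s, hs⟩ := (eventually_all.2 fun i =>
    (eventually_sum_coord_smul_ofPath hφ (hmem i)).and
      (eventually_apply_star_mul_self hφ (hmem i))).exists
  have hsum : ∑ p ∈ Finset.univ ×ˢ s,
      star (φ (ofGhostPath K y p.2 * a p.1)) * φ (ofGhostPath K y p.2 * a p.1) = 0 := by
    rw [Finset.sum_product]
    simp only [← (hs _).2, ← map_sum, ha, map_zero]
  rw [← (hs i).1]
  refine Finset.sum_eq_zero fun l hl => ?_
  rw [hK.eq_zero_of_sum_eq_zero hsum (i, l) (Finset.mk_mem_product (Finset.mem_univ i) hl),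
    zero_smul]

theorem eq_zero_of_mul_ofVertex_mem_pathSpan (hK : IsPositiveDefinite K)
    (hmem : ∀ i y, a i * ofVertex K y ∈ pathSpan K y) (ha : ∑ i, star (a i) * a i = 0) (i : ι) :
    a i = 0 :=
  eq_zero_of_forall_mul_ofVertex_eq_zero fun y =>
    eq_zero_of_mem_pathSpan hK (fun i => hmem i y) (sum_star_mul_mul_self_eq_zero ha _) i

theorem eq_zero_of_mem_ghostFiltration (hK : IsPositiveDefinite K) {n : ℕ}
    (hmem : ∀ i, a i ∈ ghostFiltration K E n) (ha : ∑ i, star (a i) * a i = 0) :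
    ∀ i, a i = 0 := by
  induction n generalizing a with
  | zero =>
    exact eq_zero_of_mul_ofVertex_mem_pathSpan hK (fun i => mul_ofVertex_mem_pathSpan (hmem i)) ha
  | succ n ih =>
    have hedge (i : ι) (e : E.Edge) : a i * ofEdge K e = 0 :=
      ih (fun i => mem_ghostFiltration_succ.1 (hmem i) e) (sum_star_mul_mul_self_eq_zero ha _) i
    exact eq_zero_of_mul_ofVertex_mem_pathSpan hK
      (fun i => mul_ofVertex_mem_pathSpan_of_forall_mul_ofEdge_eq_zero (hedge i)) ha

end PositiveDefinite

theorem isPositiveDefinite [StarRing K] (hK : IsPositiveDefinite K) :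
    IsPositiveDefinite (LeavittPathAlgebra K E) := fun _ _ a ha =>
  have ⟨_, hmem⟩ := exists_forall_mem_ghostFiltration a
  eq_zero_of_mem_ghostFiltration hK hmem ha

theorem ofVertex_ne_zero (y : E.Vertex) : ofVertex K y ≠ 0 := by
  obtain ⟨φ, hφ⟩ := exists_isPathFunctional (K := K) y
  intro h
  simpa [h] using hφ.1

theorem isPositiveDefinite_of_nonempty [StarRing K] [Nonempty E.Vertex]
    (hL : IsPositiveDefinite (LeavittPathAlgebra K E)) : IsPositiveDefinite K := by
  intro n hn k hk i
  obtain ⟨y⟩ := ‹Nonempty E.Vertex›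
  have hsum : ∑ i, star (k i • ofVertex K y) * (k i • ofVertex K y) = 0 := by
    simp only [star_smul, star_ofVertex, smul_mul_smul_comm, ofVertex_mul_self, ← Finset.sum_smul,
      hk, zero_smul]
  exact (smul_eq_zero.1 (hL n hn _ hsum i)).resolve_right (ofVertex_ne_zero y)

end

end LeavittPathAlgebra

theorem proposition2p4 (K : Type w) [Field K] [StarRing K] :
    List.TFAE
      [IsPositiveDefinite K,
        ∀ E : DirectedGraph.{u, v}, IsPositiveDefinite (LeavittPathAlgebra K E),
        ∃ E : DirectedGraph.{u, v}, Nonempty E.Vertex ∧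
          IsPositiveDefinite (LeavittPathAlgebra K E)] ∧
    ∀ E : DirectedGraph.{u, v}, Nonempty E.Vertex →
      (IsPositiveDefinite (LeavittPathAlgebra K E) ↔ IsPositiveDefinite K) := by
  refine ⟨?_, fun E _ => ⟨LeavittPathAlgebra.isPositiveDefinite_of_nonempty,
    LeavittPathAlgebra.isPositiveDefinite⟩⟩
  tfae_have 1 → 2 := fun hK _ => LeavittPathAlgebra.isPositiveDefinite hK
  tfae_have 2 → 3 := fun h => ⟨⟨PUnit, PEmpty, PEmpty.elim, PEmpty.elim⟩, ⟨⟨⟩⟩, h _⟩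
  tfae_have 3 → 1 := fun ⟨_, _, hL⟩ => LeavittPathAlgebra.isPositiveDefinite_of_nonempty hL
  tfae_finish
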